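/- Let $R$ be a commutative Noetherian ring, $J\subseteq R$ an arbitrary ideal, and put $0:J^\infty=\bigcup_{n\ge 0}(0:J^n)$. Let $s\ge 1$ be an integer and let $\prec$ be an arbitrary monomial order on the monomials in $x_1,\dots,x_s$ (a total order that is compatible with multiplication and has $1$ as its least element). For $f\in R[x_1,\dots,x_s]$ let $\operatorname{in}_\prec(f)$ be the least term of $f$ with respect to $\prec$ (with $\operatorname{in}_\prec(0)=0$, whose coefficient is $0$). A sequence $a_1,\dots,a_s\in R$ is called dependent with respect to $\prec$ if there is $f\in R[x_1,\dots,x_s]$ with $f(a_1,\dots,a_s)=0$ such that the coefficient of $\operatorname{in}_\prec(f)$ is invertible in $R$, and independent with respect to $\prec$ otherwise. If $a_1,\dots,a_s\in J$ is an independent sequence with respect to $\prec$, then $$s\le \dim R/(0:J^\infty),$$ where $\dim$ is the Krull dimension and the zero ring has dimension $-\infty$. (In particular, if $0:J^\infty=R$, then $J$ contains no independent sequence of positive length.) -/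

import Mathlib

namespace MonomialIndependence

/-- The exponent of the least monomial, with respect to the monomial order `m`, that occurs in `f`
with nonzero coefficient (by convention it is `0` for `f = 0`). -/
noncomputable def leastExponent {σ R : Type*} [CommRing R] (m : MonomialOrder σ)
    (f : MvPolynomial σ R) : σ →₀ ℕ :=
  if h : (f.support.image m.toSyn).Nonempty then
    m.toSyn.symm ((f.support.image m.toSyn).min' h)
  else 0

/-- The coefficient of the least term of `f` (it is `0` for `f = 0`). -/
noncomputable def initialCoeff {σ R : Type*} [CommRing R] (m : MonomialOrder σ)
    (f : MvPolynomial σ R) : R :=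
  f.coeff (leastExponent m f)

/-- The sequence `a 0, …, a (s - 1)` is dependent with respect to the monomial order `m` if some
polynomial vanishing at it has a least term with invertible coefficient. -/
def IsDependentSeq {R : Type*} [CommRing R] {s : ℕ} (m : MonomialOrder (Fin s))
    (a : Fin s → R) : Prop :=
  ∃ f : MvPolynomial (Fin s) R, MvPolynomial.eval a f = 0 ∧ IsUnit (initialCoeff m f)

/-- A sequence is independent with respect to `m` if it is not dependent. -/
def IsIndependentSeq {R : Type*} [CommRing R] {s : ℕ} (m : MonomialOrder (Fin s))
    (a : Fin s → R) : Prop :=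
  ¬ IsDependentSeq m a

/-- The ideal `0 : J^∞`, the union of the ascending chain of ideals `0 : J^n`, `n ≥ 0`. -/
def zeroColonPowInfty {R : Type*} [CommRing R] (J : Ideal R) : Ideal R :=
  ⨆ n : ℕ, (⊥ : Ideal R).colon ((J ^ n : Ideal R) : Set R)

/-- The supremum in the definition of `0 : J^∞` is the union. -/
theorem mem_zeroColonPowInfty {R : Type*} [CommRing R] (J : Ideal R) (x : R) :
    x ∈ zeroColonPowInfty J ↔ ∃ n : ℕ, ∀ y ∈ J ^ n, x * y = 0 := by
  have hmono : Monotone fun n : ℕ => (⊥ : Ideal R).colon ((J ^ n : Ideal R) : Set R) := by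
    intro i j hij x hx
    rw [Submodule.mem_colon] at hx ⊢
    exact fun y hy => hx y (Ideal.pow_le_pow_right hij hy)
  rw [zeroColonPowInfty, Submodule.mem_iSup_of_directed _ hmono.directed_le]
  simp [Submodule.mem_annihilator]

/-- The least exponent of a nonzero polynomial occurs in it, and is below all others. -/
theorem leastExponent_spec {σ R : Type*} [CommRing R] (m : MonomialOrder σ)
    {f : MvPolynomial σ R} (hf : f ≠ 0) :
    leastExponent m f ∈ f.support ∧
      ∀ d ∈ f.support, m.toSyn (leastExponent m f) ≤ m.toSyn d := by
  have h : (f.support.image m.toSyn).Nonempty := by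
    simpa [Finset.nonempty_iff_ne_empty] using hf
  rw [leastExponent, dif_pos h]
  constructor
  · obtain ⟨d, hd, hd'⟩ := Finset.mem_image.1 (Finset.min'_mem _ h)
    rw [← hd']
    simpa using hd
  · intro d hd
    rw [AddEquiv.apply_symm_apply]
    exact Finset.min'_le _ _ (Finset.mem_image_of_mem _ hd)

end MonomialIndependence

/-! Modulo `0 : J^∞` the sequence stays independent: a relation there lifts to `g` with least
coefficient `1`, and multiplying `g` by a power of one variable gives a relation in `R`. It remains
to show `s ≤ dim R`. If the order came from a weight `w`, one would use the extended Rees algebra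
`R[T, a_i T^{-w_i}]`. Its dimension is at most `dim R + 1`, `T` is a nonzerodivisor, and killing `T`
leaves the lowest-weight forms of the relations. If their coefficients lie in a maximal ideal `M`,
it maps onto `(R/M)[x_1, …, x_s]` with `T ↦ 0`, so `s + 1 ≤ dim R + 1`. For a general order,
independence says that the least coefficients lie in a proper ideal (`iSup_initialIdeal_ne_top`).
Noetherianity gives a weight for which all initial terms are lowest-weight forms
(`exists_weight_isWeightedInitialCoeff`); the converse (`coeff_mem_initialIdeal_of_weight`) rests on
Krull's intersection theorem. -/

namespace MonomialIndependence

/-! ### Weights inducing finitely many comparisons of a monomial order -/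

/-- A finite subset of an additive subsemigroup of `ℤⁿ` not containing `0` lies in an open rational
half-space. -/
theorem exists_rat_functional_pos : ∀ (n : ℕ) (S : Set (Fin n → ℤ)),
    (∀ x ∈ S, ∀ y ∈ S, x + y ∈ S) → (0 : Fin n → ℤ) ∉ S → ∀ D : Finset (Fin n → ℤ),
    (∀ d ∈ D, d ∈ S) → ∃ w : Fin n → ℚ, ∀ d ∈ D, 0 < ∑ i, w i * (d i : ℚ) := by
  intro n
  induction n with
  | zero =>
    intro S _ h0 D hD
    refine ⟨0, fun d hd => absurd (hD d hd) ?_⟩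
    rwa [Subsingleton.elim d 0]
  | succ n ih =>
    intro S hadd h0 D hD
    classical
    have hsmul : ∀ k : ℕ, 0 < k → ∀ x ∈ S, k • x ∈ S := by
      intro k hk x hx
      induction k, hk using Nat.le_induction with
      | base => simpa using hx
      | succ k _ ihk => rw [succ_nsmul]; exact hadd _ ihk _ hx
    let S' : Set (Fin n → ℤ) := {y | (Fin.cons 0 y : Fin (n + 1) → ℤ) ∈ S}
    -- Fourier–Motzkin elimination: for `p 0 > 0 > q 0` this positive combination has coordinate `0`
    -- equal to zero, and it stays in `S`.
    let c : (Fin (n + 1) → ℤ) → (Fin (n + 1) → ℤ) → (Fin (n + 1) → ℤ) :=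
      fun p q => (-(q 0)).toNat • p + (p 0).toNat • q
    let D0 := (D.filter fun d => d 0 = 0).image Fin.tail
    let Dp := D.filter fun d => 0 < d 0
    let Dm := D.filter fun d => d 0 < 0
    let D1 := (Dp ×ˢ Dm).image fun pq => Fin.tail (c pq.1 pq.2)
    have hcS : ∀ p ∈ Dp, ∀ q ∈ Dm, c p q ∈ S ∧ c p q 0 = 0 := by
      intro p hp q hq
      simp only [Dp, Dm, Finset.mem_filter] at hp hq
      refine ⟨hadd _ (hsmul _ (by omega) _ (hD _ hp.1)) _ (hsmul _ (by omega) _ (hD _ hq.1)), ?_⟩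
      have h1 : ((-(q 0)).toNat : ℤ) = -(q 0) := Int.toNat_of_nonneg (by omega)
      have h2 : ((p 0).toNat : ℤ) = p 0 := Int.toNat_of_nonneg (by omega)
      simp only [c, Pi.add_apply, Pi.smul_apply]
      simp only [nsmul_eq_mul, h1, h2]
      ring
    have htail : ∀ d ∈ S, d 0 = 0 → Fin.tail d ∈ S' := by
      intro d hd h
      change (Fin.cons 0 (Fin.tail d) : Fin (n + 1) → ℤ) ∈ S
      rw [← h, Fin.cons_self_tail]
      exact hd
    obtain ⟨w, hw⟩ := ih S'
      (by
        intro x hx y hy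
        have h := hadd _ hx _ hy
        have e : (Fin.cons 0 x + Fin.cons 0 y : Fin (n + 1) → ℤ) = Fin.cons 0 (x + y) := by
          ext i
          refine Fin.cases ?_ (fun j => ?_) i <;> simp
        rw [e] at h
        exact h)
      (by
        intro h
        have e : (Fin.cons 0 (0 : Fin n → ℤ) : Fin (n + 1) → ℤ) = 0 := by
          ext i
          refine Fin.cases ?_ (fun j => ?_) i <;> simp
        change (Fin.cons 0 (0 : Fin n → ℤ) : Fin (n + 1) → ℤ) ∈ S at h
        rw [e] at h
        exact h0 h)
      (D0 ∪ D1)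
      (by
        intro d hd
        rcases Finset.mem_union.1 hd with hd | hd
        · obtain ⟨e, he, rfl⟩ := Finset.mem_image.1 hd
          have he := Finset.mem_filter.1 he
          exact htail _ (hD _ he.1) he.2
        · obtain ⟨⟨p, q⟩, he, rfl⟩ := Finset.mem_image.1 hd
          have he := Finset.mem_product.1 he
          have := hcS p he.1 q he.2
          exact htail _ this.1 this.2)
    let φ : (Fin (n + 1) → ℤ) → ℚ := fun d => ∑ i, w i * (d i.succ : ℚ)
    -- Positivity of `b * d 0 + φ d` bounds `b` below on `Dp` and above on `Dm`; the bounds are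
    -- compatible because `w` is positive on each `c p q`.
    obtain ⟨b, hb1, hb2⟩ := Order.exists_between_finsets
      (Dp.image fun p => -φ p / (p 0 : ℚ)) (Dm.image fun q => φ q / (-(q 0 : ℚ))) (by
        intro x hx y hy
        obtain ⟨p, hp, rfl⟩ := Finset.mem_image.1 hx
        obtain ⟨q, hq, rfl⟩ := Finset.mem_image.1 hy
        have hpos := hw (Fin.tail (c p q)) (Finset.mem_union_right _
          (Finset.mem_image.2 ⟨(p, q), Finset.mem_product.2 ⟨hp, hq⟩, rfl⟩))
        have hp := (Finset.mem_filter.1 hp).2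
        have hq := (Finset.mem_filter.1 hq).2
        have hp' : (0 : ℚ) < p 0 := by exact_mod_cast hp
        have hq' : (0 : ℚ) < -(q 0 : ℚ) := by
          have : (q 0 : ℚ) < 0 := by exact_mod_cast hq
          linarith
        have h1 : ((-(q 0)).toNat : ℤ) = -(q 0) := Int.toNat_of_nonneg (by omega)
        have h2 : ((p 0).toNat : ℤ) = p 0 := Int.toNat_of_nonneg (by omega)
        have e : ∑ i, w i * (Fin.tail (c p q) i : ℚ) = -(q 0 : ℚ) * φ p + (p 0 : ℚ) * φ q := by
          simp only [c, φ, Fin.tail, Pi.add_apply, Pi.smul_apply]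
          simp only [nsmul_eq_mul, h1, h2, Finset.mul_sum, ← Finset.sum_add_distrib]
          refine Finset.sum_congr rfl fun i _ => ?_
          push_cast
          ring
        rw [e] at hpos
        rw [div_lt_div_iff₀ hp' hq']
        nlinarith)
    refine ⟨Fin.cons b w, fun d hd => ?_⟩
    rw [Fin.sum_univ_succ]
    simp only [Fin.cons_zero, Fin.cons_succ]
    change 0 < b * (d 0 : ℚ) + φ d
    rcases lt_trichotomy (d 0) 0 with h | h | h
    · have h' : (0 : ℚ) < -(d 0 : ℚ) := by
        have : (d 0 : ℚ) < 0 := by exact_mod_cast h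
        linarith
      have := hb2 _ (Finset.mem_image.2 ⟨d, Finset.mem_filter.2 ⟨hd, h⟩, rfl⟩)
      rw [lt_div_iff₀ h'] at this
      linarith
    · have := hw (Fin.tail d) (Finset.mem_union_left _
        (Finset.mem_image.2 ⟨d, Finset.mem_filter.2 ⟨hd, h⟩, rfl⟩))
      rw [h]
      simpa [φ, Fin.tail] using this
    · have h' : (0 : ℚ) < d 0 := by exact_mod_cast h
      have := hb1 _ (Finset.mem_image.2 ⟨d, Finset.mem_filter.2 ⟨hd, h⟩, rfl⟩)
      rw [div_lt_iff₀ h'] at this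
      linarith

/-- On finitely many pairs of monomials, a monomial order is induced by a weight. -/
theorem exists_weight_lt {s : ℕ} (m : MonomialOrder (Fin s))
    (D : Finset ((Fin s →₀ ℕ) × (Fin s →₀ ℕ))) (hD : ∀ p ∈ D, m.toSyn p.1 < m.toSyn p.2) :
    ∃ w : Fin s → ℕ, ∀ p ∈ D, Finsupp.weight w p.1 < Finsupp.weight w p.2 := by
  classical
  let δ : (Fin s →₀ ℕ) × (Fin s →₀ ℕ) → Fin s → ℤ := fun p i => (p.2 i : ℤ) - p.1 i
  let S : Set (Fin s → ℤ) := {x | ∃ p, m.toSyn p.1 < m.toSyn p.2 ∧ δ p = x}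
  obtain ⟨w, hw⟩ := exists_rat_functional_pos s S
    (by
      rintro _ ⟨p, hp, rfl⟩ _ ⟨q, hq, rfl⟩
      refine ⟨p + q, ?_, ?_⟩
      · simp only [Prod.fst_add, Prod.snd_add, map_add]
        exact add_lt_add hp hq
      · ext i
        simp [δ]
        ring)
    (by
      rintro ⟨p, hp, h⟩
      refine hp.ne (congrArg _ (Finsupp.ext fun i => ?_))
      have := congrFun h i
      simp only [δ, Pi.zero_apply] at this
      omega)
    -- The unit vectors force every weight to be positive, so that clearing denominators gives
    -- natural numbers.
    (D.image δ ∪ Finset.univ.image fun i => δ (0, Finsupp.single i 1))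
    (by
      intro d hd
      rcases Finset.mem_union.1 hd with hd | hd
      · obtain ⟨p, hp, rfl⟩ := Finset.mem_image.1 hd
        exact ⟨p, hD p hp, rfl⟩
      · obtain ⟨i, -, rfl⟩ := Finset.mem_image.1 hd
        refine ⟨_, ?_, rfl⟩
        refine lt_of_le_of_ne (m.toSyn_monotone zero_le) fun h => ?_
        simpa using (DFunLike.congr_fun (m.toSyn.injective h) i).symm)
  have hpos : ∀ i, 0 < w i := by
    intro i
    have := hw (δ (0, Finsupp.single i 1)) (Finset.mem_union_right _
      (Finset.mem_image_of_mem _ (Finset.mem_univ i)))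
    simpa [δ, Finsupp.single_apply] using this
  let N : ℕ := ∏ i, (w i).den
  have hN : 0 < N := Finset.prod_pos fun i _ => (w i).pos
  have hex : ∀ i, ∃ k : ℕ, (k : ℚ) = N * w i := by
    intro i
    obtain ⟨t, ht⟩ := Finset.dvd_prod_of_mem (fun i => (w i).den) (Finset.mem_univ i)
    refine ⟨t * (w i).num.toNat, ?_⟩
    have h1 : (((w i).num.toNat : ℤ) : ℚ) = (w i).num := by
      rw [Int.toNat_of_nonneg (Rat.num_pos.2 (hpos i)).le]
    have h2 : (w i) * ((w i).den : ℚ) = (w i).num := Rat.mul_den_eq_num _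
    have h3 : (N : ℚ) = ((w i).den : ℚ) * t := by exact_mod_cast ht
    rw [Int.cast_natCast] at h1
    push_cast
    rw [h1, h3, ← h2]
    ring
  choose k hk using hex
  refine ⟨k, fun p hp => ?_⟩
  have h := hw (δ p) (Finset.mem_union_left _ (Finset.mem_image_of_mem _ hp))
  have e : ∀ d : Fin s →₀ ℕ, ((Finsupp.weight k d : ℕ) : ℚ) = N * ∑ i, w i * (d i : ℚ) := by
    intro d
    rw [Finsupp.weight_apply, Finsupp.sum_fintype _ _ (by simp)]
    push_cast [smul_eq_mul]
    rw [Finset.mul_sum]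
    refine Finset.sum_congr rfl fun i _ => ?_
    rw [hk]
    ring
  have : ((Finsupp.weight k p.1 : ℕ) : ℚ) < (Finsupp.weight k p.2 : ℕ) := by
    rw [e, e]
    refine mul_lt_mul_of_pos_left ?_ (by exact_mod_cast hN)
    rw [← sub_pos, ← Finset.sum_sub_distrib]
    refine h.trans_eq (Finset.sum_congr rfl fun i _ => ?_)
    simp only [δ]
    push_cast
    ring
  exact_mod_cast this

/-! ### Ideals of initial coefficients and Krull's intersection theorem -/

open MvPolynomial

section

variable {R : Type*} [CommRing R] {s : ℕ}

/-- The coefficients at `u` of the polynomials that vanish at `a` and contain no monomial below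
`u`. -/
def initialIdeal (m : MonomialOrder (Fin s)) (a : Fin s → R) (u : Fin s →₀ ℕ) : Ideal R where
  carrier := {c | ∃ f : MvPolynomial (Fin s) R, eval a f = 0 ∧ f.coeff u = c ∧
    ∀ d, m.toSyn d < m.toSyn u → f.coeff d = 0}
  zero_mem' := ⟨0, by simp⟩
  add_mem' := by
    rintro _ _ ⟨f, hf, rfl, hf'⟩ ⟨g, hg, rfl, hg'⟩
    exact ⟨f + g, by simp [hf, hg], by simp, fun d hd => by simp [hf' d hd, hg' d hd]⟩
  smul_mem' := by
    rintro r _ ⟨f, hf, rfl, hf'⟩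
    exact ⟨C r * f, by simp [hf], by simp, fun d hd => by simp [hf' d hd]⟩

theorem mem_initialIdeal {m : MonomialOrder (Fin s)} {a : Fin s → R} {u : Fin s →₀ ℕ} {c : R} :
    c ∈ initialIdeal m a u ↔ ∃ f : MvPolynomial (Fin s) R, eval a f = 0 ∧ f.coeff u = c ∧
      ∀ d, m.toSyn d < m.toSyn u → f.coeff d = 0 := Iff.rfl

/-- Relations can be multiplied by monomials. Hence the supremum of these ideals is a directed
union. -/
theorem initialIdeal_mono (m : MonomialOrder (Fin s)) (a : Fin s → R) :
    Monotone (initialIdeal m a) := by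
  rintro u v huv c ⟨f, hf, rfl, hf'⟩
  obtain ⟨t, rfl⟩ := exists_add_of_le huv
  refine ⟨monomial t 1 * f, by simp [hf], by simp [add_comm u t, coeff_monomial_mul], ?_⟩
  intro d hd
  rw [coeff_monomial_mul']
  split_ifs with h
  · obtain ⟨e, rfl⟩ := exists_add_of_le h
    rw [add_tsub_cancel_left, hf' e, mul_zero]
    rw [map_add, map_add, add_comm] at hd
    exact lt_of_add_lt_add_right hd
  · rfl

theorem iSup_initialIdeal_ne_top {m : MonomialOrder (Fin s)} {a : Fin s → R}
    (ha : IsIndependentSeq m a) : ⨆ u, initialIdeal m a u ≠ ⊤ := by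
  intro h
  have h1 : (1 : R) ∈ ⨆ u, initialIdeal m a u := h ▸ Submodule.mem_top
  rw [Submodule.mem_iSup_of_directed _ (initialIdeal_mono m a).directed_le] at h1
  obtain ⟨u, f, hf, hu, hf'⟩ := h1
  rcases subsingleton_or_nontrivial R with _ | _
  -- In the zero ring the coefficient `0` is a unit, so the zero polynomial is already a dependence.
  · exact ha ⟨0, by simp, isUnit_of_subsingleton _⟩
  refine ha ⟨f, hf, ?_⟩
  have hf0 : f ≠ 0 := by
    rintro rfl
    simp at hu
  obtain ⟨hl, hle⟩ := leastExponent_spec m hf0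
  have : leastExponent m f = u := by
    refine m.toSyn.injective (le_antisymm (hle u (by simp [mem_support_iff, hu])) ?_)
    by_contra! hlt
    exact (mem_support_iff.1 hl) (hf' _ hlt)
  rw [initialCoeff, this, hu]
  exact isUnit_one

/-- The ideal generated by the values at `a` of all monomials above `u`. -/
def higherIdeal (m : MonomialOrder (Fin s)) (a : Fin s → R) (u : Fin s →₀ ℕ) : Ideal R :=
  Ideal.span {x | ∃ v, m.toSyn u < m.toSyn v ∧ eval a (monomial v 1) = x}

theorem mem_initialIdeal_of_mul_mem {m : MonomialOrder (Fin s)} {a : Fin s → R}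
    {u : Fin s →₀ ℕ} {c : R} (h : eval a (monomial u c) ∈ higherIdeal m a u) :
    c ∈ initialIdeal m a u := by
  have key : ∀ x ∈ higherIdeal m a u, ∃ p : MvPolynomial (Fin s) R, eval a p = x ∧
      ∀ d, m.toSyn d ≤ m.toSyn u → p.coeff d = 0 := by
    intro x hx
    induction hx using Submodule.span_induction with
    | mem x hx =>
      obtain ⟨v, hv, rfl⟩ := hx
      refine ⟨monomial v 1, rfl, fun d hd => ?_⟩
      rw [coeff_monomial, if_neg]
      rintro rfl
      exact hd.not_gt hv
    | zero => exact ⟨0, by simp⟩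
    | add x y _ _ hx hy =>
      obtain ⟨p, rfl, hp⟩ := hx
      obtain ⟨q, rfl, hq⟩ := hy
      exact ⟨p + q, by simp, fun d hd => by simp [hp d hd, hq d hd]⟩
    | smul r x _ hx =>
      obtain ⟨p, rfl, hp⟩ := hx
      exact ⟨C r * p, by simp, fun d hd => by simp [hp d hd]⟩
  obtain ⟨p, hp, hp'⟩ := key _ h
  refine ⟨monomial u c - p, by simp only [map_sub, hp, sub_self], by simp [hp' u le_rfl], ?_⟩
  intro d hd
  have : u ≠ d := by
    rintro rfl
    exact hd.false
  simp [hp' d hd.le, coeff_monomial, this]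

theorem mem_higherIdeal_of_coeff {m : MonomialOrder (Fin s)} {a : Fin s → R}
    {u : Fin s →₀ ℕ} {J : Ideal R} {p : MvPolynomial (Fin s) R} (hp : eval a p ∈ J)
    (h : ∀ d, d ≠ u → p.coeff d ≠ 0 → m.toSyn u < m.toSyn d ∨ eval a (monomial d 1) ∈ J) :
    eval a (monomial u (p.coeff u)) ∈ higherIdeal m a u ⊔ J := by
  classical
  have e : eval a p = ∑ d ∈ insert u p.support, eval a (monomial d (p.coeff d)) := by
    conv_lhs => rw [p.as_sum, map_sum]
    refine Finset.sum_subset (Finset.subset_insert _ _) fun d _ hd => ?_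
    rw [notMem_support_iff.1 hd]
    simp
  rw [← Finset.add_sum_erase _ _ (Finset.mem_insert_self _ _)] at e
  rw [← sub_eq_iff_eq_add.2 e]
  refine sub_mem (Ideal.mem_sup_right hp) (sum_mem fun d hd => ?_)
  by_cases h0 : p.coeff d = 0
  · simp [h0]
  have e' : eval a (monomial d (p.coeff d)) = p.coeff d * eval a (monomial d 1) := by
    simp [eval_monomial]
  rw [e']
  refine Ideal.mul_mem_left _ _ ?_
  rcases h d (Finset.mem_erase.1 hd).1 h0 with h | h
  · exact Ideal.mem_sup_left (Ideal.subset_span ⟨d, h, rfl⟩)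
  · exact Ideal.mem_sup_right h

/-- Krull's intersection theorem in a quotient. -/
theorem exists_mul_sub_mem_of_forall_mem_sup_pow [IsNoetherianRing R] {I K : Ideal R} {x : R}
    (h : ∀ n, x ∈ K ⊔ I ^ n) : ∃ r ∈ I, r * x - x ∈ K := by
  have hx : Submodule.Quotient.mk (p := K) x ∈ (⨅ i : ℕ, I ^ i • ⊤ : Submodule R (R ⧸ K)) := by
    rw [Submodule.mem_iInf]
    intro n
    obtain ⟨y, hy, z, hz, rfl⟩ := Submodule.mem_sup.1 (h n)
    have : Submodule.Quotient.mk (p := K) (y + z) = z • Submodule.Quotient.mk (p := K) 1 := by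
      rw [← Submodule.Quotient.mk_smul, Submodule.Quotient.eq]
      simpa using hy
    rw [this]
    exact Submodule.smul_mem_smul hz trivial
  obtain ⟨r, hr⟩ := (Ideal.mem_iInf_smul_pow_eq_bot_iff I _).1 hx
  refine ⟨r, r.2, ?_⟩
  rw [← Submodule.Quotient.mk_smul, Submodule.Quotient.eq] at hr
  simpa using hr

/-- Krull gives `r` in `(a)` with `r * x - x` in the higher ideal, where `x` is the value of the
term. Multiplication by any `a i` raises the monomial, so `r * x`, and therefore `x`, lies there
too; no local hypothesis is needed. -/
theorem mem_initialIdeal_of_forall_pow [IsNoetherianRing R] {m : MonomialOrder (Fin s)}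
    {a : Fin s → R} {u : Fin s →₀ ℕ} {c : R}
    (h : ∀ n, eval a (monomial u c) ∈ higherIdeal m a u ⊔ Ideal.span (Set.range a) ^ n) :
    c ∈ initialIdeal m a u := by
  obtain ⟨r, hr, hrx⟩ := exists_mul_sub_mem_of_forall_mem_sup_pow h
  refine mem_initialIdeal_of_mul_mem ?_
  have hr' : r * eval a (monomial u c) ∈ higherIdeal m a u := by
    refine Submodule.span_induction (p := fun r _ => r * eval a (monomial u c) ∈ higherIdeal m a u)
      ?_ (by simp) (fun x y _ _ hx hy => by rw [add_mul]; exact add_mem hx hy)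
      (fun t x _ hx => by rw [smul_mul_assoc]; exact Submodule.smul_mem _ t hx) hr
    rintro _ ⟨i, rfl⟩
    have e : a i * eval a (monomial u c) = c * eval a (monomial (Finsupp.single i 1 + u) 1) := by
      have : monomial (Finsupp.single i 1 + u) (1 : R) = X i * monomial u 1 := by
        rw [X, monomial_mul, one_mul]
      rw [this, map_mul, eval_X]
      simp only [eval_monomial]
      ring
    rw [e]
    refine Ideal.mul_mem_left _ _ (Ideal.subset_span ⟨_, ?_, rfl⟩)
    rw [map_add]
    refine lt_add_of_pos_left _ (lt_of_le_of_ne ?_ fun h => ?_)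
    · rw [← map_zero m.toSyn]
      exact m.toSyn_monotone zero_le
    · rw [← map_zero m.toSyn] at h
      simpa using (DFunLike.congr_fun (m.toSyn.injective h) i).symm
  simpa using sub_mem hr' hrx

theorem eval_monomial_mem_pow (a : Fin s → R) (d : Fin s →₀ ℕ) {n : ℕ} (h : n ≤ d.degree) :
    eval a (monomial d 1) ∈ Ideal.span (Set.range a) ^ n := by
  refine Ideal.pow_le_pow_right h ?_
  rw [eval_monomial, one_mul, Finsupp.degree_eq_sum, Finsupp.prod_fintype _ _ (by simp),
    ← Finset.prod_pow_eq_pow_sum]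
  exact Ideal.prod_mem_prod fun i _ => Ideal.pow_mem_pow
    (Ideal.subset_span (Set.mem_range_self i)) _

/-! ### From the monomial order to a weight and back -/

/-- `c` is the coefficient at `v` of a polynomial that vanishes at `a` and in which all other
monomials have larger weight than `v`. -/
def IsWeightedInitialCoeff (a : Fin s → R) (w : Fin s → ℕ) (v : Fin s →₀ ℕ) (c : R) : Prop :=
  ∃ q : MvPolynomial (Fin s) R, eval a q = 0 ∧ q.coeff v = c ∧
    ∀ d, d ≠ v → q.coeff d ≠ 0 → Finsupp.weight w v < Finsupp.weight w d

namespace IsWeightedInitialCoeff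

variable {a : Fin s → R} {w : Fin s → ℕ}

theorem zero (v : Fin s →₀ ℕ) : IsWeightedInitialCoeff a w v 0 := ⟨0, by simp⟩

theorem add {v : Fin s →₀ ℕ} {c c' : R} (h : IsWeightedInitialCoeff a w v c)
    (h' : IsWeightedInitialCoeff a w v c') : IsWeightedInitialCoeff a w v (c + c') := by
  obtain ⟨q, hq, rfl, hq'⟩ := h
  obtain ⟨p, hp, rfl, hp'⟩ := h'
  refine ⟨q + p, by simp [hq, hp], by simp, fun d hd h => ?_⟩
  by_cases h0 : q.coeff d = 0
  · exact hp' d hd (by simpa [h0] using h)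
  · exact hq' d hd h0

theorem sum {ι : Type*} {v : Fin s →₀ ℕ} {t : Finset ι} {c : ι → R}
    (h : ∀ i ∈ t, IsWeightedInitialCoeff a w v (c i)) :
    IsWeightedInitialCoeff a w v (∑ i ∈ t, c i) :=
  Finset.sum_induction _ _ (fun _ _ => add) (zero v) h

theorem mul {v : Fin s →₀ ℕ} {c : R} (h : IsWeightedInitialCoeff a w v c) (u : Fin s →₀ ℕ)
    (r : R) : IsWeightedInitialCoeff a w (u + v) (r * c) := by
  obtain ⟨q, hq, rfl, hq'⟩ := h
  refine ⟨monomial u r * q, by simp [hq], by simp [coeff_monomial_mul], fun d hd h => ?_⟩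
  rw [coeff_monomial_mul'] at h
  split_ifs at h with hu
  · obtain ⟨e, rfl⟩ := exists_add_of_le hu
    rw [add_tsub_cancel_left] at h
    rw [map_add, map_add]
    refine Nat.add_lt_add_left (hq' e ?_ (right_ne_zero_of_mul h)) _
    rintro rfl
    exact hd rfl
  · exact absurd rfl h

end IsWeightedInitialCoeff

/-- The initial terms with respect to a monomial order are also initial with respect to a suitable
natural-number weight. -/
theorem exists_weight_isWeightedInitialCoeff [IsNoetherianRing R] (m : MonomialOrder (Fin s))
    (a : Fin s → R) : ∃ w : Fin s → ℕ,
      ∀ v, ∀ c ∈ initialIdeal m a v, IsWeightedInitialCoeff a w v c := by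
  classical
  let G : Set (MvPolynomial (Fin s) R) := {g | ∃ v, ∃ c ∈ initialIdeal m a v, g = monomial v c}
  -- Finitely many initial terms generate all of them, so `w` only has to respect the comparisons
  -- inside one relation per generator.
  obtain ⟨T, hT, hspan⟩ := (Submodule.fg_span_iff_fg_span_finset_subset G).1
    (IsNoetherian.noetherian (Submodule.span (MvPolynomial (Fin s) R) G))
  have hT' : ∀ g ∈ T, ∃ v, ∃ c ∈ initialIdeal m a v, g = monomial v c := fun g hg => hT hg
  choose! v c hc hmon using hT'
  have hc' : ∀ g ∈ T, ∃ f : MvPolynomial (Fin s) R, eval a f = 0 ∧ f.coeff (v g) = c g ∧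
      ∀ d, m.toSyn d < m.toSyn (v g) → f.coeff d = 0 := fun g hg => hc g hg
  choose! f hf hfc hfd using hc'
  obtain ⟨w, hwD⟩ := exists_weight_lt m
    (T.biUnion fun g => ((f g).support.erase (v g)).image fun d => (v g, d)) (by
      intro p hp
      obtain ⟨g, hg, hp⟩ := Finset.mem_biUnion.1 hp
      obtain ⟨d, hd, rfl⟩ := Finset.mem_image.1 hp
      obtain ⟨hd, hd'⟩ := Finset.mem_erase.1 hd
      refine lt_of_le_of_ne ?_ fun h => hd (m.toSyn.injective h).symm
      by_contra! hlt
      exact mem_support_iff.1 hd' (hfd g hg d hlt))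
  refine ⟨w, fun u x hx => ?_⟩
  have key : ∀ p ∈ Submodule.span (MvPolynomial (Fin s) R) (T : Set (MvPolynomial (Fin s) R)),
      ∀ u, IsWeightedInitialCoeff a w u (p.coeff u) := by
    intro p hp
    induction hp using Submodule.span_induction with
    | mem g hg =>
      intro u
      have hg' := hmon g hg
      rw [hg', coeff_monomial]
      split_ifs with h
      · subst h
        refine ⟨f g, hf g hg, hfc g hg, fun d hd h => hwD (v g, d) ?_⟩
        exact Finset.mem_biUnion.2 ⟨g, hg, Finset.mem_image_of_mem _
          (Finset.mem_erase.2 ⟨hd, mem_support_iff.2 h⟩)⟩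
      · exact .zero u
    | zero => exact fun u => .zero u
    | add p q _ _ hp hq => exact fun u => by simpa using (hp u).add (hq u)
    | smul r p _ hp =>
      intro u
      rw [smul_eq_mul, coeff_mul]
      refine .sum fun ij hij => ?_
      rw [← Finset.HasAntidiagonal.mem_antidiagonal.1 hij]
      exact (hp _).mul _ _
  have := key (monomial u x) (hspan ▸ Submodule.subset_span ⟨u, x, hx, rfl⟩) u
  simpa using this

/-- Each removable term of weight `k` is the whole lowest form of some relation; subtracting these
relations otherwise changes only weights above `k`. -/
theorem exists_reduction_step {m : MonomialOrder (Fin s)} {a : Fin s → R} {w : Fin s → ℕ}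
    (hW : ∀ v, ∀ c ∈ initialIdeal m a v, IsWeightedInitialCoeff a w v c)
    (p : MvPolynomial (Fin s) R) (hp : eval a p = 0) (k : ℕ) :
    ∃ p' : MvPolynomial (Fin s) R, eval a p' = 0 ∧
      (∀ d, Finsupp.weight w d < k → p'.coeff d = p.coeff d) ∧
      (∀ d, Finsupp.weight w d = k → p.coeff d ∉ initialIdeal m a d →
        p'.coeff d = p.coeff d) ∧
      (∀ d, Finsupp.weight w d = k → p.coeff d ∈ initialIdeal m a d → p'.coeff d = 0) := by
  classical
  let F := p.support.filter fun v => Finsupp.weight w v = k ∧ p.coeff v ∈ initialIdeal m a v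
  have hF : ∀ v, ∃ q : MvPolynomial (Fin s) R, v ∈ F → eval a q = 0 ∧ q.coeff v = p.coeff v ∧
      ∀ d, d ≠ v → q.coeff d ≠ 0 → Finsupp.weight w v < Finsupp.weight w d := by
    intro v
    by_cases hv : v ∈ F
    · obtain ⟨q, hq⟩ := hW v _ (Finset.mem_filter.1 hv).2.2
      exact ⟨q, fun _ => hq⟩
    · exact ⟨0, fun h => absurd h hv⟩
  choose q hq using hF
  have hcoeff : ∀ d, Finsupp.weight w d ≤ k →
      (∑ v ∈ F, q v).coeff d = if d ∈ F then p.coeff d else 0 := by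
    intro d hd
    have hne : ∀ v ∈ F, v ≠ d → (q v).coeff d = 0 := by
      intro v hv hvd
      by_contra h
      have := (hq v hv).2.2 d hvd.symm h
      have := (Finset.mem_filter.1 hv).2.1
      omega
    rw [coeff_sum]
    split_ifs with h
    · rw [Finset.sum_eq_single_of_mem d h hne, (hq d h).2.1]
    · exact Finset.sum_eq_zero fun v hv => hne v hv (by rintro rfl; exact h hv)
  refine ⟨p - ∑ v ∈ F, q v, ?_, fun d hd => ?_, fun d hd hd' => ?_, fun d hd hd' => ?_⟩
  · rw [map_sub, hp, map_sum, Finset.sum_eq_zero fun v hv => (hq v hv).1, sub_zero]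
  · rw [coeff_sub, hcoeff d hd.le, if_neg, sub_zero]
    intro h
    have := (Finset.mem_filter.1 h).2.1
    omega
  · rw [coeff_sub, hcoeff d hd.le, if_neg, sub_zero]
    exact fun h => hd' (Finset.mem_filter.1 h).2.2
  · rw [coeff_sub, hcoeff d hd.le]
    split_ifs with h
    · exact sub_self _
    · rw [sub_zero]
      by_contra h0
      exact h (Finset.mem_filter.2 ⟨mem_support_iff.2 h0, hd, hd'⟩)

theorem weight_le_sum_mul_degree (w : Fin s → ℕ) (d : Fin s →₀ ℕ) :
    Finsupp.weight w d ≤ (∑ i, w i) * d.degree := by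
  rw [Finsupp.weight_apply, Finsupp.sum_fintype _ _ (by simp), Finsupp.degree_eq_sum,
    Finset.mul_sum]
  refine Finset.sum_le_sum fun i _ => ?_
  rw [smul_eq_mul, mul_comm]
  exact Nat.mul_le_mul_right _ (Finset.single_le_sum (f := w) (fun _ _ => zero_le)
    (Finset.mem_univ i))

/-- If the initial terms for a monomial order are initial for a weight, then conversely the
coefficients of all forms of lowest weight occur in initial terms for the monomial order. -/
theorem coeff_mem_initialIdeal_of_weight [IsNoetherianRing R] {m : MonomialOrder (Fin s)}
    {a : Fin s → R} {w : Fin s → ℕ}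
    (hW : ∀ v, ∀ c ∈ initialIdeal m a v, IsWeightedInitialCoeff a w v c)
    {g : MvPolynomial (Fin s) R} (hg : eval a g = 0) {n : ℕ}
    (hlow : ∀ d, Finsupp.weight w d < n → g.coeff d = 0) {v : Fin s →₀ ℕ}
    (hv : Finsupp.weight w v = n) : g.coeff v ∈ initialIdeal m a v := by
  classical
  by_contra hgv
  choose step hstep0 hstep_lt hstep_out hstep_mem using
    fun (p : {p : MvPolynomial (Fin s) R // eval a p = 0}) (k : ℕ) =>
      exists_reduction_step hW p.1 p.2 k
  -- `P k` is `g` after reduction in weights `n, …, n + k - 1`. Coefficients of weight below `n + k`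
  -- are then final, and `H` is the limiting formal power series.
  let P : ℕ → {p : MvPolynomial (Fin s) R // eval a p = 0} := fun k =>
    Nat.rec ⟨g, hg⟩ (fun k p => ⟨step p (n + k), hstep0 p (n + k)⟩) k
  have hP : ∀ k, (P (k + 1)).1 = step (P k) (n + k) := fun k => rfl
  have hstable : ∀ d k j, Finsupp.weight w d < n + k →
      (P (k + j)).1.coeff d = (P k).1.coeff d := by
    intro d k j hd
    induction j with
    | zero => rfl
    | succ j ih => rw [← add_assoc, hP, hstep_lt _ _ _ (by omega), ih]
  let H : (Fin s →₀ ℕ) → R := fun d => (P (Finsupp.weight w d + 1)).1.coeff d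
  have hH : ∀ d k, Finsupp.weight w d < n + k → (P k).1.coeff d = H d := by
    intro d k hd
    rw [← hstable d k (Finsupp.weight w d + 1) hd, add_comm,
      hstable d (Finsupp.weight w d + 1) k (by omega)]
  have hnormal : ∀ d, H d ∈ initialIdeal m a d → H d = 0 := by
    intro d hd
    rcases lt_or_ge (Finsupp.weight w d) n with h | h
    · rw [← hH d 0 (by omega)]
      exact hlow d h
    · obtain ⟨k, hk⟩ := exists_add_of_le h
      rw [← hH d (k + 1) (by omega), hP] at hd ⊢
      by_cases hc : (P k).1.coeff d ∈ initialIdeal m a d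
      · exact hstep_mem _ _ _ hk hc
      · rw [hstep_out _ _ _ hk hc] at hd
        exact absurd hd hc
  have hHv : H v ≠ 0 := by
    have : H v = g.coeff v := by
      rw [← hH v 1 (by omega)]
      exact hstep_out ⟨g, hg⟩ n v hv hgv
    rw [this]
    intro h0
    exact hgv (h0 ▸ zero_mem _)
  -- The least exponent of `H` gives the contradiction: modulo each power of `(a)`, the term of `H`
  -- at `u` has its value in the higher ideal.
  obtain ⟨u, hu, hmin⟩ := (InvImage.wf m.toSyn wellFounded_lt).has_min {d | H d ≠ 0} ⟨v, hHv⟩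
  refine hu (hnormal u (mem_initialIdeal_of_forall_pow fun N => ?_))
  -- The first summands put `u` in the stable range; the last makes every monomial of weight at
  -- least `n + k` have degree at least `N`.
  set k := Finsupp.weight w u + 1 + (∑ i, w i) * N with hk
  rw [← hH u k (by omega)]
  refine mem_higherIdeal_of_coeff (by rw [(P k).2]; exact zero_mem _) fun d hdu hd => ?_
  rcases lt_or_ge (Finsupp.weight w d) (n + k) with h | h
  · left
    rw [hH d k h] at hd
    exact lt_of_le_of_ne (not_lt.1 (hmin d hd)) fun h => hdu (m.toSyn.injective h).symm
  · right
    refine eval_monomial_mem_pow a d ?_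
    have := weight_le_sum_mul_degree w d
    by_contra! hlt
    have := Nat.mul_le_mul_left (∑ i, w i) hlt.le
    omega

end

/-! ### The extended Rees algebra and the dimension bound -/

variable {R : Type*} [CommRing R]

/-- Adjoining a fraction with nonzerodivisor denominator does not raise the Krull dimension. -/
theorem exists_subring_adjoin_fraction {C : Type*} [CommRing C] (S : Subring C)
    [IsNoetherianRing S] {t y : C} (ht : t ∈ nonZeroDivisors C) (htS : t ∈ S)
    (hy : t * y ∈ S) : ∃ S' : Subring C, IsNoetherianRing S' ∧ S ≤ S' ∧ y ∈ S' ∧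
      (∀ U : Subring C, S ≤ U → y ∈ U → S' ≤ U) ∧ ringKrullDim S' ≤ ringKrullDim S := by
  let f : Polynomial S →+* C := Polynomial.eval₂RingHom S.subtype y
  have hf : Function.Surjective f.rangeRestrict := f.rangeRestrict_surjective
  refine ⟨f.range, isNoetherianRing_of_surjective _ _ _ hf, fun x hx => ?_, ?_, ?_, ?_⟩
  · exact ⟨Polynomial.C ⟨x, hx⟩, by simp [f]⟩
  · exact ⟨Polynomial.X, by simp [f]⟩
  · rintro U hSU hyU _ ⟨p, rfl⟩
    simp only [f, Polynomial.coe_eval₂RingHom, Polynomial.eval₂_eq_sum_range]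
    exact sum_mem fun i _ => mul_mem (hSU (p.coeff i).2) (pow_mem hyU i)
  · let τ : S := ⟨t, htS⟩
    -- The kernel of `S[X] → S[y]` contains `t X - t y`, whose leading coefficient is a
    -- nonzerodivisor; this offsets the dimension gained from `X`.
    let r : Polynomial S := Polynomial.C τ * Polynomial.X - Polynomial.C ⟨t * y, hy⟩
    have hτ : τ ∈ nonZeroDivisors S := by
      rw [mem_nonZeroDivisors_iff_right]
      intro x hx
      refine Subtype.ext ((mem_nonZeroDivisors_iff_right.1 ht) _ ?_)
      exact congrArg Subtype.val hx
    have hr : r ∈ nonZeroDivisors (Polynomial S) := by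
      refine Polynomial.mem_nonZeroDivisors_of_leadingCoeff ?_
      rcases subsingleton_or_nontrivial S with _ | _
      · rwa [Subsingleton.elim r.leadingCoeff τ]
      have h0 : τ ≠ 0 := nonZeroDivisors.ne_zero hτ
      have : r.leadingCoeff = τ := by
        simp only [r, sub_eq_add_neg, ← Polynomial.C_neg]
        exact Polynomial.leadingCoeff_linear h0
      rwa [this]
    have h0 : f.rangeRestrict r = 0 := by
      refine Subtype.ext ?_
      simp [f, r, τ]
    have h1 := ringKrullDim_succ_le_of_surjective _ hf hr h0
    rw [Polynomial.ringKrullDim_of_isNoetherianRing] at h1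
    exact ENat.WithBot.add_le_add_one_right_iff.1 h1

/-- Adjoining finitely many fractions whose denominators are powers of a nonzerodivisor does not
raise the Krull dimension. -/
theorem exists_subring_adjoin_fractions {C ι : Type*} [CommRing C] (S : Subring C)
    [IsNoetherianRing S] {t : C} (ht : t ∈ nonZeroDivisors C) (htS : t ∈ S) (y : ι → C)
    (hy : ∀ i, ∃ k : ℕ, t ^ k * y i ∈ S) (F : Finset ι) :
    ∃ S' : Subring C, IsNoetherianRing S' ∧ S ≤ S' ∧ (∀ i ∈ F, y i ∈ S') ∧
      (∀ U : Subring C, S ≤ U → (∀ i ∈ F, y i ∈ U) → S' ≤ U) ∧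
      ringKrullDim S' ≤ ringKrullDim S := by
  classical
  induction F using Finset.induction_on with
  | empty => exact ⟨S, inferInstance, le_rfl, by simp, fun U h _ => h, le_rfl⟩
  | insert i F _ ih =>
    obtain ⟨S₁, _, hS₁, hy₁, hU₁, hdim₁⟩ := ih
    obtain ⟨k, hk⟩ := hy i
    obtain ⟨S₂, hN, hS₂, hy₂, hU₂, hdim₂⟩ := exists_subring_adjoin_fraction S₁ (pow_mem ht k)
      (pow_mem (hS₁ htS) k) (hS₁ hk)
    refine ⟨S₂, hN, hS₁.trans hS₂, ?_, ?_, hdim₂.trans hdim₁⟩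
    · intro j hj
      rcases Finset.mem_insert.1 hj with rfl | hj
      · exact hy₂
      · exact hS₂ (hy₁ j hj)
    · intro U hU hyU
      exact hU₂ U (hU₁ U hU fun j hj => hyU j (Finset.mem_insert_of_mem hj))
        (hyU i (Finset.mem_insert_self _ _))

open LaurentPolynomial in
/-- The presentation of the extended Rees algebra of the filtration defined by giving `a i` the
weight `w i`. -/
noncomputable def reesPresentation {s : ℕ} (a : Fin s → R) (w : Fin s → ℕ) :
    MvPolynomial (Fin s) (Polynomial R) →+* R[T;T⁻¹] :=
  eval₂Hom Polynomial.toLaurent fun i => LaurentPolynomial.C (a i) * T (-(w i : ℤ))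

section

variable {s : ℕ} (a : Fin s → R) (w : Fin s → ℕ)

open LaurentPolynomial in
theorem T_one_mem_nonZeroDivisors : (T 1 : R[T;T⁻¹]) ∈ nonZeroDivisors R[T;T⁻¹] :=
  (isUnit_T 1).mem_nonZeroDivisors

/-- The image arises from `R[T]` by adjoining the fractions `a i / T ^ w i`. -/
theorem ringKrullDim_range_reesPresentation_le [IsNoetherianRing R] :
    ringKrullDim (reesPresentation a w).range ≤ ringKrullDim R + 1 := by
  let S : Subring (LaurentPolynomial R) := (Polynomial.toLaurent (R := R)).range
  have hsurj := (Polynomial.toLaurent (R := R)).rangeRestrict_surjective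
  have : IsNoetherianRing S := isNoetherianRing_of_surjective _ _ _ hsurj
  have hS : ringKrullDim S ≤ ringKrullDim R + 1 := by
    rw [← Polynomial.ringKrullDim_of_isNoetherianRing]
    exact ringKrullDim_le_of_surjective _ hsurj
  obtain ⟨S', -, hSS', hy, hU, hdim⟩ := exists_subring_adjoin_fractions S
    T_one_mem_nonZeroDivisors ⟨Polynomial.X, Polynomial.toLaurent_X⟩
    (fun i => LaurentPolynomial.C (a i) * LaurentPolynomial.T (-(w i : ℤ))) (fun i => by
      refine ⟨w i, Polynomial.C (a i), ?_⟩
      rw [Polynomial.toLaurent_C, LaurentPolynomial.T_pow, mul_left_comm,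
        ← LaurentPolynomial.T_add]
      simp) Finset.univ
  have : (reesPresentation a w).range = S' := by
    refine le_antisymm ?_ (hU _ ?_ fun i _ => ⟨X i, by simp [reesPresentation]⟩)
    · rintro _ ⟨p, rfl⟩
      induction p using MvPolynomial.induction_on with
      | C p => exact hSS' ⟨p, by simp [reesPresentation]⟩
      | add p q hp hq => rw [map_add]; exact add_mem hp hq
      | mul_X p i hp =>
        rw [map_mul]
        refine mul_mem hp ?_
        simpa [reesPresentation] using hy i (Finset.mem_univ i)
    · rintro _ ⟨p, rfl⟩
      exact ⟨C p, by simp [reesPresentation]⟩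
  rw [this]
  exact hdim.trans hS

theorem reesPresentation_monomial (d : Fin s →₀ ℕ) (p : Polynomial R) :
    reesPresentation a w (monomial d p) = Polynomial.toLaurent p *
      (LaurentPolynomial.C (eval a (monomial d 1)) *
        LaurentPolynomial.T (-(Finsupp.weight w d : ℤ))) := by
  rw [reesPresentation, coe_eval₂Hom, eval₂_monomial]
  congr 1
  rw [eval_monomial, one_mul, Finsupp.weight_apply, Finsupp.prod_fintype _ _ (by simp),
    Finsupp.prod_fintype _ _ (by simp), Finsupp.sum_fintype _ _ (by simp)]
  simp only [mul_pow, Finset.prod_mul_distrib, map_prod, map_pow, LaurentPolynomial.T_pow]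
  congr 1
  push_cast
  rw [← Finset.sum_neg_distrib]
  induction (Finset.univ : Finset (Fin s)) using Finset.induction_on with
  | empty => simp
  | insert i F hi ih =>
    rw [Finset.prod_insert hi, Finset.sum_insert hi, ih, LaurentPolynomial.T_add]
    congr 2
    simp [smul_eq_mul]

/-- A term `X ^ k * x ^ d` lands in `T`-degree `k - weight d`; the case split guards the truncated
subtraction. -/
theorem coeff_reesPresentation_monomial (d : Fin s →₀ ℕ) (p : Polynomial R) (n : ℕ) :
    (reesPresentation a w (monomial d p)).coeff (-(n : ℤ)) =
      if n ≤ Finsupp.weight w d then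
        eval a (monomial d (p.coeff (Finsupp.weight w d - n))) else 0 := by
  rw [reesPresentation_monomial]
  induction p using Polynomial.induction_on' with
  | add p q hp hq =>
    rw [map_add, add_mul, AddMonoidAlgebra.coeff_add, Finsupp.add_apply, hp, hq]
    split_ifs <;> simp
  | monomial k r =>
    rw [← Polynomial.C_mul_X_pow_eq_monomial, Polynomial.toLaurent_C_mul_X_pow,
      mul_mul_mul_comm, ← map_mul, ← LaurentPolynomial.T_add,
      ← LaurentPolynomial.single_eq_C_mul_T, AddMonoidAlgebra.coeff_single,
      Finsupp.single_apply, Polynomial.coeff_C_mul_X_pow]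
    simp only [eval_monomial, one_mul]
    by_cases h : n ≤ Finsupp.weight w d
    · by_cases h' : Finsupp.weight w d - n = k
      · rw [if_pos (by omega), if_pos h, if_pos h']
      · rw [if_neg (by omega), if_pos h, if_neg h', zero_mul]
    · rw [if_neg (by omega), if_neg h]

/-- The relations of the extended Rees algebra reduce modulo the variable of the Laurent polynomials
to forms of lowest weight of polynomials vanishing at `a`. -/
theorem coeff_zero_mem_of_reesPresentation_eq_zero {L : Ideal R}
    (hL : ∀ g : MvPolynomial (Fin s) R, eval a g = 0 → ∀ n,
      (∀ d, Finsupp.weight w d < n → g.coeff d = 0) →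
      ∀ d, Finsupp.weight w d = n → g.coeff d ∈ L)
    {F : MvPolynomial (Fin s) (Polynomial R)} (hF : reesPresentation a w F = 0)
    (d : Fin s →₀ ℕ) : (F.coeff d).coeff 0 ∈ L := by
  classical
  set n := Finsupp.weight w d with hn
  -- `g` collects the terms of `F` landing in `T`-degree `-n`, with `X` set to `1`. Its weights are
  -- at least `n`, and in weight `n` only constant coefficients of `F` remain.
  let c : (Fin s →₀ ℕ) → R := fun e =>
    if n ≤ Finsupp.weight w e then (F.coeff e).coeff (Finsupp.weight w e - n) else 0
  let g : MvPolynomial (Fin s) R := ∑ e ∈ F.support, monomial e (c e)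
  have hg : ∀ e, g.coeff e = c e := by
    intro e
    simp only [g, coeff_sum, coeff_monomial, Finset.sum_ite_eq']
    split_ifs with h
    · rfl
    · simp [c, notMem_support_iff.1 h]
  have h0 : eval a g = 0 := by
    have h := congrArg (fun p : LaurentPolynomial R => p.coeff (-(n : ℤ))) hF
    rw [F.as_sum, map_sum] at h
    simp only [AddMonoidAlgebra.coeff_sum, Finsupp.finsetSum_apply,
      coeff_reesPresentation_monomial] at h
    rw [map_sum]
    refine Eq.trans (Finset.sum_congr rfl fun e _ => ?_) h
    simp only [c]
    split_ifs <;> simp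
  have := hL g h0 n (fun e he => by rw [hg]; exact if_neg he.not_ge) d hn.symm
  rw [hg] at this
  simpa [c, ← hn] using this

/-- If the forms of lowest weight of all polynomials vanishing at `a` have coefficients in a proper
ideal, then the length of `a` is at most the Krull dimension. -/
theorem le_ringKrullDim_of_weight [IsNoetherianRing R] {L : Ideal R} (hL1 : L ≠ ⊤)
    (hL : ∀ g : MvPolynomial (Fin s) R, eval a g = 0 → ∀ n,
      (∀ d, Finsupp.weight w d < n → g.coeff d = 0) →
      ∀ d, Finsupp.weight w d = n → g.coeff d ∈ L) :
    (s : WithBot ℕ∞) ≤ ringKrullDim R := by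
  obtain ⟨M, hM, hLM⟩ := L.exists_le_maximal hL1
  let _ : Field (R ⧸ M) := Ideal.Quotient.field M
  let Φ := (reesPresentation a w).rangeRestrict
  have hΦ : Function.Surjective Φ := (reesPresentation a w).rangeRestrict_surjective
  let ψ : MvPolynomial (Fin s) (Polynomial R) →+* MvPolynomial (Fin s) (R ⧸ M) :=
    map ((Ideal.Quotient.mk M).comp Polynomial.constantCoeff)
  have hψ : Function.Surjective ψ := map_surjective _
    (Ideal.Quotient.mk_surjective.comp Polynomial.constantCoeff_surjective)
  have hker : RingHom.ker Φ ≤ RingHom.ker ψ := by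
    intro F hF
    ext d
    have hF' : reesPresentation a w F = 0 := congrArg Subtype.val ((RingHom.mem_ker).1 hF)
    have := hLM (coeff_zero_mem_of_reesPresentation_eq_zero a w hL hF' d)
    simpa [ψ, coeff_map] using Ideal.Quotient.eq_zero_iff_mem.2 this
  let χ := RingHom.liftOfSurjective Φ hΦ ⟨ψ, hker⟩
  have hχ : ∀ F, χ (Φ F) = ψ F := RingHom.liftOfRightInverse_comp_apply _ _ _ _
  have hχs : Function.Surjective χ := fun q => by
    obtain ⟨F, rfl⟩ := hψ q
    exact ⟨Φ F, hχ F⟩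
  let τ := Φ (C Polynomial.X)
  have hτ : τ ∈ nonZeroDivisors (reesPresentation a w).range := by
    rw [mem_nonZeroDivisors_iff_right]
    intro x hx
    refine Subtype.ext ((mem_nonZeroDivisors_iff_right.1 T_one_mem_nonZeroDivisors) _ ?_)
    have hτT : (τ : LaurentPolynomial R) = LaurentPolynomial.T 1 :=
      (eval₂Hom_C _ _ _).trans Polynomial.toLaurent_X
    rw [← hτT]
    exact congrArg Subtype.val hx
  have hχτ : χ τ = 0 := by
    rw [hχ]
    simp [ψ]
  -- The nonzerodivisor `τ` (that is, `T`) dies under `χ`, so the polynomial ring over the field has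
  -- dimension at least one less than the Rees algebra.
  have h1 := (ringKrullDim_succ_le_of_surjective χ hχs hτ hχτ).trans
    (ringKrullDim_range_reesPresentation_le a w)
  rw [MvPolynomial.ringKrullDim_of_isNoetherianRing, ringKrullDim_eq_zero_of_field, zero_add,
    Nat.card_eq_fintype_card, Fintype.card_fin] at h1
  exact ENat.WithBot.add_le_add_one_right_iff.1 h1

end

/-- The length of an independent sequence is at most the Krull dimension. -/
theorem IsIndependentSeq.le_ringKrullDim [IsNoetherianRing R] {s : ℕ} {m : MonomialOrder (Fin s)}
    {a : Fin s → R} (ha : IsIndependentSeq m a) : (s : WithBot ℕ∞) ≤ ringKrullDim R := by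
  obtain ⟨w, hW⟩ := exists_weight_isWeightedInitialCoeff m a
  refine le_ringKrullDim_of_weight a w (iSup_initialIdeal_ne_top ha) fun g hg n hlow d hd => ?_
  exact Ideal.mem_iSup_of_mem d (coeff_mem_initialIdeal_of_weight hW hg hlow hd)

/-! ### Reduction modulo `0 : J^∞` -/

/-- A unit multiple of a polynomial over `R ⧸ K` with invertible initial coefficient lifts to a
polynomial over `R` with initial coefficient `1`. -/
theorem exists_lift_initialCoeff_eq_one {s : ℕ} (m : MonomialOrder (Fin s)) (K : Ideal R)
    (f : MvPolynomial (Fin s) (R ⧸ K)) (hf : IsUnit (initialCoeff m f)) :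
    ∃ (g : MvPolynomial (Fin s) R) (b : R ⧸ K) (u : Fin s →₀ ℕ),
      map (Ideal.Quotient.mk K) g = C b * f ∧ g.coeff u = 1 ∧
      ∀ d, m.toSyn d < m.toSyn u → g.coeff d = 0 := by
  classical
  obtain ⟨b, hb⟩ := hf.exists_left_inv
  set u := leastExponent m f with hu
  have hlow : ∀ d, m.toSyn d < m.toSyn u → f.coeff d = 0 := by
    intro d hd
    rcases eq_or_ne f 0 with rfl | hf0
    · simp
    · by_contra h
      exact hd.not_ge ((leastExponent_spec m hf0).2 d (mem_support_iff.2 h))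
  -- An arbitrary lift could create smaller terms with coefficients in `K` and a non-unit at `u`;
  -- zeros are therefore lifted to `0` and the coefficient at `u` to `1`.
  let σ : (Fin s →₀ ℕ) → R := fun d =>
    if d = u then 1 else if f.coeff d = 0 then 0 else (b * f.coeff d).out
  have hσ : ∀ d, Ideal.Quotient.mk K (σ d) = b * f.coeff d := by
    intro d
    simp only [σ]
    split_ifs with h h'
    · rw [h, map_one, ← hb]
      rfl
    · rw [h', mul_zero, map_zero]
    · exact Ideal.Quotient.mk_out _
  have hg : ∀ d, (∑ e ∈ insert u f.support, monomial e (σ e)).coeff d = σ d := by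
    intro d
    simp only [coeff_sum, coeff_monomial, Finset.sum_ite_eq']
    split_ifs with h
    · rfl
    · rw [Finset.mem_insert, not_or] at h
      simp [σ, h.1, notMem_support_iff.1 h.2]
  refine ⟨∑ e ∈ insert u f.support, monomial e (σ e), b, u, ?_, ?_, ?_⟩
  · ext d
    rw [coeff_map, hg, hσ, coeff_C_mul]
  · rw [hg]
    exact if_pos rfl
  · intro d hd
    rw [hg]
    have : d ≠ u := by
      rintro rfl
      exact hd.false
    simp [σ, this, hlow d hd]

/-- An independent sequence in `J` stays independent modulo `0 : J^∞`. -/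
theorem IsIndependentSeq.quotient_zeroColonPowInfty {s : ℕ} (hs : 0 < s)
    {m : MonomialOrder (Fin s)} {a : Fin s → R} (ha : IsIndependentSeq m a) {J : Ideal R}
    (haJ : ∀ i, a i ∈ J) :
    IsIndependentSeq m fun i => Ideal.Quotient.mk (zeroColonPowInfty J) (a i) := by
  rintro ⟨f, hf, hunit⟩
  obtain ⟨g, b, u, hgf, hgu, hlow⟩ := exists_lift_initialCoeff_eq_one m _ f hunit
  have hmem : eval a g ∈ zeroColonPowInfty J := by
    rw [← Ideal.Quotient.eq_zero_iff_mem]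
    have := congrArg (eval fun i => Ideal.Quotient.mk (zeroColonPowInfty J) (a i)) hgf
    rw [map_mul, hf, mul_zero, eval_map] at this
    rw [← this]
    exact eval₂_comp_left _ _ _ _
  obtain ⟨n, hn⟩ := (mem_zeroColonPowInfty J _).1 hmem
  -- Since `s > 0` there is a variable `x_0`; `a_0 ^ n` lies in `J ^ n` and kills `g(a)`, so `x_0 ^
  -- n * g` is a relation with least coefficient `1`.
  refine iSup_initialIdeal_ne_top ha ((Ideal.eq_top_iff_one _).2 (Ideal.mem_iSup_of_mem
    (Finsupp.single ⟨0, hs⟩ n + u) ⟨monomial (Finsupp.single ⟨0, hs⟩ n) 1 * g, ?_, ?_, ?_⟩))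
  · rw [map_mul, mul_comm]
    refine hn _ ?_
    rw [← X_pow_eq_monomial, map_pow, eval_X]
    exact Ideal.pow_mem_pow (haJ _) n
  · rw [coeff_monomial_mul, one_mul, hgu]
  · intro d hd
    rw [coeff_monomial_mul']
    split_ifs with h
    · obtain ⟨e, rfl⟩ := exists_add_of_le h
      rw [add_tsub_cancel_left, hlow e, mul_zero]
      rw [map_add, map_add] at hd
      exact lt_of_add_lt_add_left hd
    · rfl

end MonomialIndependence

theorem proposition2p9 {R : Type*} [CommRing R] [IsNoetherianRing R] (J : Ideal R)
    (s : ℕ) (hs : 0 < s) (m : MonomialOrder (Fin s)) (a : Fin s → R) (haJ : ∀ i, a i ∈ J)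
    (ha : MonomialIndependence.IsIndependentSeq m a) :
    (s : WithBot ℕ∞) ≤ ringKrullDim (R ⧸ MonomialIndependence.zeroColonPowInfty J) :=
  (ha.quotient_zeroColonPowInfty hs haJ).le_ringKrullDim
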